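/- Let $\Psi=(X^*,\Phi,X_*,\Phi^\vee)$ be a root datum (with $X^*$, $X_*$ finitely generated free abelian groups and $\Phi$ finite, not necessarily reduced), with Weyl group $W$, and let $\Gamma$ be a finite group of automorphisms of $\Psi$ that stabilizes a set $\Delta\subset\Phi$ of simple roots (that is, $\Delta$ is linearly independent, and every root is an integral combination of elements of $\Delta$ with all coefficients nonnegative or all coefficients nonpositive). Let $\bar X^*$ be the quotient of the module of coinvariants $X^*_\Gamma$ by its torsion submodule, let $i^*\colon X^*\to\bar X^*$ be the quotient map, and put $\bar\Phi=i^*(\Phi)$ and $\bar X_*=X_*^\Gamma$. For $\beta\in\Phi$ let $\Xi_\beta=\Gamma\cdot\beta$ if the orbit $\Gamma\cdot\beta$ is orthogonal (i.e. its distinct elements are pairwise orthogonal), and otherwise let $\Xi_\beta$ be the set of roots of the form $\theta+\theta'$, where $\theta,\theta'\in\Gamma\cdot\beta$ are distinct and not orthogonal. Let $W^\Gamma$ be the subgroup of elements of $W$ fixed by $\Gamma$ (acting by conjugation). Then $\bar X^*$ and $\bar X_*$ are finitely generated free abelian groups, $\bar\Phi$ is finite, $|\Xi_\beta|$ divides $|\Gamma\cdot\beta|$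 for every $\beta\in\Phi$, and there is a (possibly non-reduced) root datum $\bar\Psi=(\bar X^*,\bar\Phi,\bar X_*,\bar\Phi^\vee)$ in which 1. the perfect pairing is induced by that of $\Psi$: $\langle i^*x,\lambda\rangle=\langle x,\lambda\rangle$ for $x\in X^*$, $\lambda\in X_*^\Gamma$; 2. the coroot of $\alpha\in\bar\Phi$ is $$\alpha^\vee=\frac{|\Gamma\cdot\beta|}{|\Xi_\beta|}\sum_{\xi\in\Xi_\beta}\xi^\vee\in\bar X_*$$ for every $\beta\in\Phi$ with $i^*\beta=\alpha$ (so the right-hand side does not depend on the choice of $\beta$). Moreover the Weyl group $\bar W$ of $\bar\Psi$ embeds naturally in $W^\Gamma$: there is a unique injective group homomorphism $f\colon\bar W\to W^\Gamma$ such that $\bar w(i^*x)=i^*(f(\bar w)\,x)$ for all $\bar w\in\bar W$ and $x\in X^*$. -/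

import Mathlib

namespace RootPairing

/-- A set of simple roots (a base) of a possibly non-reduced root datum, given by the set `Δ` of
indices of its elements: the simple roots are linearly independent, and every root is a
combination of simple roots with integer coefficients that are all nonnegative or all nonpositive.
(`RootPairing.Base` also asks for the same conditions on the coroots of the elements of `Δ`, and
this fails for non-reduced root data.) -/
def IsSimpleSet {ι X Y : Type*} [AddCommGroup X] [AddCommGroup Y]
    (Ψ : RootDatum ι X Y) (Δ : Set ι) : Prop :=
  LinearIndepOn ℤ Ψ.root Δ ∧
    ∀ i : ι, Ψ.root i ∈ AddSubmonoid.closure (Ψ.root '' Δ) ∨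
      -Ψ.root i ∈ AddSubmonoid.closure (Ψ.root '' Δ)

/-- The action of a group `Γ` of automorphisms of `Ψ` on the lattice `X` that contains the
roots. -/
noncomputable def weightRep {ι X Y : Type*} [AddCommGroup X] [AddCommGroup Y]
    (Ψ : RootDatum ι X Y) (Γ : Subgroup Ψ.Aut) : Representation ℤ Γ X :=
  Representation.ofDistribMulAction ℤ Γ X

/-- The module of `Γ`-coinvariants of `X`, modulo torsion. -/
abbrev RestrictedWeight {ι X Y : Type*} [AddCommGroup X] [AddCommGroup Y]
    (Ψ : RootDatum ι X Y) (Γ : Subgroup Ψ.Aut) : Type _ :=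
  (weightRep Ψ Γ).Coinvariants ⧸ Submodule.torsion ℤ (weightRep Ψ Γ).Coinvariants

/-- The restriction map from `X` to its `Γ`-coinvariants modulo torsion. -/
noncomputable def restrict {ι X Y : Type*} [AddCommGroup X] [AddCommGroup Y]
    (Ψ : RootDatum ι X Y) (Γ : Subgroup Ψ.Aut) : X →ₗ[ℤ] RestrictedWeight Ψ Γ :=
  (Submodule.torsion ℤ (weightRep Ψ Γ).Coinvariants).mkQ ∘ₗ
    Representation.Coinvariants.mk (weightRep Ψ Γ)

/-- The lattice of `Γ`-fixed elements of `Y`. An automorphism `γ` acts on `Y` by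
`(coweightMap γ)⁻¹`, which has the same fixed points as `coweightMap γ`. -/
def fixedCoweight {ι X Y : Type*} [AddCommGroup X] [AddCommGroup Y]
    (Ψ : RootDatum ι X Y) (Γ : Subgroup Ψ.Aut) : Submodule ℤ Y where
  carrier := {y | ∀ γ ∈ Γ, γ.toHom.coweightMap y = y}
  add_mem' ha hb γ hγ := by rw [map_add, ha γ hγ, hb γ hγ]
  zero_mem' γ _ := map_zero _
  smul_mem' c a ha γ hγ := by rw [map_smul, ha γ hγ]

/-- The set of restrictions of roots. -/
def restrictedRoots {ι X Y : Type*} [AddCommGroup X] [AddCommGroup Y]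
    (Ψ : RootDatum ι X Y) (Γ : Subgroup Ψ.Aut) : Set (RestrictedWeight Ψ Γ) :=
  Set.range fun β : ι => restrict Ψ Γ (Ψ.root β)

open Classical in
/-- The set `Ξ_β` of (indices of) roots: it is the orbit `Γ · β` if this orbit is orthogonal, and
otherwise it consists of the roots `θ + θ'` with `θ`, `θ'` distinct and not orthogonal in
`Γ · β`. -/
noncomputable def Xi {ι X Y : Type*} [AddCommGroup X] [AddCommGroup Y]
    (Ψ : RootDatum ι X Y) (Γ : Subgroup Ψ.Aut) (β : ι) : Set ι :=
  if (MulAction.orbit Γ β).Pairwise Ψ.IsOrthogonal then MulAction.orbit Γ β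
  else {ξ | ∃ θ ∈ MulAction.orbit Γ β, ∃ θ' ∈ MulAction.orbit Γ β,
    θ' ≠ θ ∧ ¬ Ψ.IsOrthogonal θ θ' ∧ Ψ.root ξ = Ψ.root θ + Ψ.root θ'}

/-- The subgroup `W^Γ` of the Weyl group `W` of `Ψ`: the elements that are fixed by `Γ`, which acts
on `W` by conjugation. -/
def fixedWeylGroup {ι X Y : Type*} [AddCommGroup X] [AddCommGroup Y]
    (Ψ : RootDatum ι X Y) (Γ : Subgroup Ψ.Aut) : Subgroup Ψ.Aut where
  carrier := {w | w ∈ Ψ.weylGroup ∧ ∀ γ ∈ Γ, γ * w * γ⁻¹ = w}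
  mul_mem' {a b} ha hb := ⟨mul_mem ha.1 hb.1, fun γ hγ => by
    rw [← conj_mul, ha.2 γ hγ, hb.2 γ hγ]⟩
  one_mem' := ⟨one_mem _, fun γ _ => by simp⟩
  inv_mem' {a} ha := ⟨inv_mem ha.1, fun γ hγ => by
    rw [← conj_inv, ha.2 γ hγ]⟩

end RootPairing

/-! The height attached to `Δ` is constant on each `Γ`-orbit of roots and nonzero on every root, so
the difference of two roots in an orbit is never a root and distinct members pair nonpositively. The
orbit sum S is nonzero and fixed by `Γ`, so the positive invariant form gives (S, β) > 0: the
pairings of the orbit with β, one of which is 2, have positive sum. Hence at most one other member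
fails to be orthogonal to β, and it pairs to -1 (`exists_partner`). So Ξ_β is an orthogonal orbit
whose members restrict to m times the restriction of β, with m = |Γβ|/|Ξ_β| equal to 1 or 2
(`exists_Xi_eq_orbit`).

The product of the reflections in Ξ_β lies in W^Γ and acts on restricted weights as the reflection
with the prescribed coroot (`exists_restrict_smul_eq`). With N the norm map of `Γ`, this coroot is x
↦ 2(Nβ, x)/(Nβ, β) (`rootForm_normMap_mul`). Since Nβ and the restriction of β determine each other,
this formula gives independence of β, injectivity of the coroot map and equivariance under W^Γ,
hence the root datum axioms.

An element of W^Γ that acts trivially on restricted weights preserves heights of roots, hence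
positivity, and is therefore 1 (`eq_of_restrict_smul_eq`). So lifts of restricted Weyl elements to
W^Γ are unique, which makes lifting a homomorphism. -/

namespace RootPairing

/-! ### Automorphisms, reflections and the invariant form. -/

section Aut

variable {ι X Y : Type*} [AddCommGroup X] [AddCommGroup Y] (Ψ : RootDatum ι X Y)

lemma root_smul (g : Ψ.Aut) (i : ι) : Ψ.root (g • i) = g • Ψ.root i :=
  Equiv.root_indexEquiv_eq_smul Ψ i g

lemma toLinearMap_smul (g : Ψ.Aut) (x : X) (y : Y) :
    Ψ.toLinearMap (g • x) y = Ψ.toLinearMap x (g.toHom.coweightMap y) :=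
  LinearMap.congr_fun (Hom.weight_coweight_transpose_apply Ψ Ψ y g.toHom) x

lemma coweightMap_coroot_smul (g : Ψ.Aut) (i : ι) :
    g.toHom.coweightMap (Ψ.coroot (g • i)) = Ψ.coroot i := by
  rw [Hom.coroot_coweightMap_apply]
  congr 1
  exact g.toHom.indexEquiv.symm_apply_apply i

lemma toLinearMap_smul_coroot_smul (g : Ψ.Aut) (x : X) (i : ι) :
    Ψ.toLinearMap (g • x) (Ψ.coroot (g • i)) = Ψ.toLinearMap x (Ψ.coroot i) := by
  rw [toLinearMap_smul, coweightMap_coroot_smul]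

lemma pairing_smul_smul (g : Ψ.Aut) (i j : ι) :
    Ψ.pairing (g • i) (g • j) = Ψ.pairing i j := by
  rw [← root_coroot_eq_pairing, root_smul, toLinearMap_smul_coroot_smul, root_coroot_eq_pairing]

lemma rootForm_smul_smul [Fintype ι] (g : Ψ.Aut) (x y : X) :
    Ψ.RootForm (g • x) (g • y) = Ψ.RootForm x y := by
  simp only [rootForm_apply_apply]
  rw [← Fintype.sum_equiv (MulAction.toPerm g) _ _ fun i ↦ rfl]
  simp [toLinearMap_smul_coroot_smul]

lemma rootForm_root_self_mul [Fintype ι] (i : ι) (x : X) :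
    Ψ.RootForm (Ψ.root i) (Ψ.root i) * Ψ.toLinearMap x (Ψ.coroot i) =
      2 * Ψ.RootForm (Ψ.root i) x := by
  have h := congrArg (Ψ.toLinearMap x) (Ψ.rootForm_self_smul_coroot i)
  rw [map_smul, map_nsmul, toLinearMap_apply_apply_Polarization] at h
  simpa using h

lemma rootForm_root_root [Fintype ι] (i j : ι) :
    Ψ.RootForm (Ψ.root i) (Ψ.root i) * Ψ.pairing j i = 2 * Ψ.RootForm (Ψ.root i) (Ψ.root j) :=
  Ψ.rootForm_root_self_mul i (Ψ.root j)

lemma rootForm_root_self_pos [Fintype ι] (i : ι) : 0 < Ψ.RootForm (Ψ.root i) (Ψ.root i) :=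
  Ψ.rootForm_pos_of_ne_zero (Submodule.subset_span ⟨i, rfl⟩) (Ψ.ne_zero i)

variable {Ψ} in
lemma aut_ext {g h : Ψ.Aut} (H : ∀ x : X, g • x = h • x) : g = h :=
  Equiv.weightHom_injective Ψ (LinearEquiv.ext H)

lemma aut_smul_reflection (g : Ψ.Aut) (i : ι) (x : X) :
    g • Ψ.reflection i x = Ψ.reflection (g • i) (g • x) := by
  simp only [reflection_apply, smul_sub, LinearMap.flip_apply, toLinearMap_smul_coroot_smul,
    root_smul, smul_comm g]

lemma conj_reflection (g : Ψ.Aut) (i : ι) :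
    g * Equiv.reflection Ψ i * g⁻¹ = Equiv.reflection Ψ (g • i) := by
  refine aut_ext fun x ↦ ?_
  rw [mul_smul, mul_smul, Equiv.reflection_smul, aut_smul_reflection, smul_inv_smul,
    Equiv.reflection_smul]

lemma reflection_mul_self (i : ι) : Equiv.reflection Ψ i * Equiv.reflection Ψ i = 1 := by
  nth_rw 2 [← Equiv.reflection_inv]
  exact mul_inv_cancel _

include Ψ in
lemma isAddTorsionFree_left : IsAddTorsionFree X :=
  have : Module.IsReflexive ℤ X := .of_isPerfPair Ψ.toLinearMap
  .of_isTorsionFree ℤ X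

include Ψ in
lemma isAddTorsionFree_right : IsAddTorsionFree Y :=
  Ψ.flip.isAddTorsionFree_left

lemma eq_of_forall_toLinearMap_eq {y z : Y} (h : ∀ x, Ψ.toLinearMap x y = Ψ.toLinearMap x z) :
    y = z :=
  (LinearMap.IsPerfPair.bijective_right Ψ.toLinearMap).1 (LinearMap.ext h)

/-- Roots with proportional directions define the same reflection. -/
lemma reflection_eq_of_root_eq_smul [Finite ι] {i j : ι} {t : ℤ}
    (h : Ψ.root j = t • Ψ.root i) : Equiv.reflection Ψ j = Equiv.reflection Ψ i := by
  have := Ψ.isAddTorsionFree_right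
  refine aut_ext fun x ↦ ?_
  rw [Equiv.reflection_smul, Equiv.reflection_smul, reflection_apply, reflection_apply, h,
    LinearMap.flip_apply, LinearMap.flip_apply, ← Ψ.smul_coroot_eq_of_root_eq_smul i j t h,
    map_smul, smul_eq_mul, mul_comm, mul_smul]

end Aut

/-! ### Coordinates and positivity for a set of simple roots. -/

section SimpleSet

variable {ι X Y : Type*} [AddCommGroup X] [AddCommGroup Y] {Ψ : RootDatum ι X Y} {Δ : Set ι}

/-- Linearly independent vectors in an abelian group admit rational coordinate functionals. -/
lemma exists_rat_coord {κ A : Type*} [AddCommGroup A] {v : κ → A} (hv : LinearIndependent ℤ v) :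
    ∃ c : κ → A →ₗ[ℤ] ℚ, ∀ k l, c k (v l) = Finsupp.single l (1 : ℚ) k := by
  -- Divisibility of ℚ extends the coordinate from the span to all of `A`; over ℤ this could fail,
  -- since the span need not be a direct summand.
  have H (k : κ) : ∃ c : A →ₗ[ℤ] ℚ, ∀ l, c (v l) = Finsupp.single l (1 : ℚ) k := by
    obtain ⟨c, hc⟩ := (Module.Baer.of_divisible ℚ).extension_property
      (Finsupp.linearCombination ℤ v) hv
      ((Algebra.linearMap ℤ ℚ) ∘ₗ (Finsupp.lapply k : (κ →₀ ℤ) →ₗ[ℤ] ℤ))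
    refine ⟨c, fun l ↦ ?_⟩
    have := LinearMap.congr_fun hc (Finsupp.single l 1)
    simp only [LinearMap.comp_apply, Finsupp.linearCombination_single, one_smul] at this
    rw [this]
    classical
    simp [Finsupp.single_apply]
  choose c hc using H
  exact ⟨c, hc⟩

namespace IsSimpleSet

variable (hΔ : IsSimpleSet Ψ Δ)
include hΔ

/-- The coordinate functionals of a set of simple roots. -/
noncomputable def coord : Δ → X →ₗ[ℤ] ℚ := (exists_rat_coord hΔ.1).choose

lemma coord_root (k l : Δ) : hΔ.coord k (Ψ.root l) = Finsupp.single l (1 : ℚ) k :=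
  (exists_rat_coord hΔ.1).choose_spec k l

lemma coord_root_self (k : Δ) : hΔ.coord k (Ψ.root k) = 1 := by
  simp [coord_root]

lemma coord_root_of_ne {k l : Δ} (h : k ≠ l) : hΔ.coord k (Ψ.root l) = 0 := by
  simp [coord_root, h]

lemma coord_nonneg {x : X} (hx : x ∈ AddSubmonoid.closure (Ψ.root '' Δ)) (k : Δ) :
    0 ≤ hΔ.coord k x := by
  induction hx using AddSubmonoid.closure_induction with
  | mem x hx =>
    obtain ⟨l, hl, rfl⟩ := hx
    rw [hΔ.coord_root k ⟨l, hl⟩]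
    classical
    rw [Finsupp.single_apply]
    split_ifs <;> norm_num
  | zero => simp
  | add x y _ _ hx hy => rw [map_add]; positivity

lemma exists_eq_sum {x : X} (hx : x ∈ Submodule.span ℤ (Ψ.root '' Δ)) :
    ∃ c : Δ →₀ ℤ, x = c.sum (fun k n ↦ n • Ψ.root k) ∧ ∀ k, hΔ.coord k x = c k := by
  rw [Set.image_eq_range, Finsupp.mem_span_range_iff_exists_finsupp] at hx
  obtain ⟨c, rfl⟩ := hx
  refine ⟨c, rfl, fun k ↦ ?_⟩
  rw [Finsupp.sum, map_sum, Finset.sum_eq_single k]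
  · simp [coord_root_self]
  · intro l _ hl
    rw [map_zsmul, hΔ.coord_root_of_ne hl.symm, smul_zero]
  · intro h
    simp [Finsupp.notMem_support_iff.mp h]

lemma eq_zero_of_coord {x : X} (hx : x ∈ Submodule.span ℤ (Ψ.root '' Δ))
    (h : ∀ k, hΔ.coord k x = 0) : x = 0 := by
  obtain ⟨c, hc, hc'⟩ := hΔ.exists_eq_sum hx
  have : c = 0 := by
    ext k
    have := (hc' k).symm.trans (h k)
    simpa using this
  rw [hc, this, Finsupp.sum_zero_index]

omit hΔ in
lemma closure_le_span : (AddSubmonoid.closure (Ψ.root '' Δ) : Set X) ⊆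
    Submodule.span ℤ (Ψ.root '' Δ) :=
  fun _ hx ↦ AddSubmonoid.closure_le (S := (Submodule.span ℤ (Ψ.root '' Δ)).toAddSubmonoid) |>.mpr
    Submodule.subset_span hx

lemma root_mem_span (i : ι) : Ψ.root i ∈ Submodule.span ℤ (Ψ.root '' Δ) := by
  rcases hΔ.2 i with h | h
  · exact closure_le_span h
  · simpa using neg_mem (closure_le_span h)

lemma coord_nonneg_or_nonpos (i : ι) : (∀ k, 0 ≤ hΔ.coord k (Ψ.root i)) ∨
    ∀ k, hΔ.coord k (Ψ.root i) ≤ 0 := by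
  rcases hΔ.2 i with h | h
  · exact .inl fun k ↦ hΔ.coord_nonneg h k
  · refine .inr fun k ↦ ?_
    simpa using hΔ.coord_nonneg h k

lemma exists_coord_ne_zero (i : ι) : ∃ k, hΔ.coord k (Ψ.root i) ≠ 0 := by
  by_contra! h
  exact Ψ.ne_zero i (hΔ.eq_zero_of_coord (hΔ.root_mem_span i) h)

/-- A root is positive if one of its coordinates is positive, in which case none is negative. -/
def IsPos (i : ι) : Prop := ∃ k, 0 < hΔ.coord k (Ψ.root i)

lemma IsPos.coord_nonneg {i : ι} (h : hΔ.IsPos i) (k : Δ) : 0 ≤ hΔ.coord k (Ψ.root i) := by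
  obtain ⟨l, hl⟩ := h
  rcases hΔ.coord_nonneg_or_nonpos i with h | h
  · exact h k
  · exact absurd (h l) hl.not_ge

lemma coord_nonpos_of_not_isPos {i : ι} (h : ¬ hΔ.IsPos i) (k : Δ) :
    hΔ.coord k (Ψ.root i) ≤ 0 := by
  by_contra! hk
  exact h ⟨k, hk⟩

lemma isPos_of_neg {i j : ι} (h : ¬ hΔ.IsPos i) (hij : Ψ.root j = -Ψ.root i) : hΔ.IsPos j := by
  obtain ⟨k, hk⟩ := hΔ.exists_coord_ne_zero i
  refine ⟨k, ?_⟩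
  rw [hij, map_neg, Left.neg_pos_iff]
  exact lt_of_le_of_ne (hΔ.coord_nonpos_of_not_isPos h k) hk

lemma not_isPos_of_neg {i j : ι} (h : hΔ.IsPos i) (hij : Ψ.root j = -Ψ.root i) :
    ¬ hΔ.IsPos j := by
  rintro ⟨k, hk⟩
  rw [hij, map_neg, Left.neg_pos_iff] at hk
  exact absurd (IsPos.coord_nonneg hΔ h k) hk.not_ge

lemma isPos_simple (k : Δ) : hΔ.IsPos k := ⟨k, by rw [coord_root_self]; norm_num⟩

/-- The reflection in a simple root makes a positive root negative only if this root is a multiple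
of the simple root. -/
lemma exists_eq_smul_of_not_isPos (k : Δ) {i : ι} (h : hΔ.IsPos i)
    (h' : ¬ hΔ.IsPos (Equiv.reflection Ψ (k : ι) • i)) :
    ∃ t : ℤ, Ψ.root i = t • Ψ.root k := by
  -- The simple reflection changes only the `k`-th coordinate, so every other coordinate is both
  -- nonnegative and nonpositive.
  have key (l : Δ) (hl : l ≠ k) : hΔ.coord l (Ψ.root i) = 0 := by
    refine le_antisymm ?_ (IsPos.coord_nonneg hΔ h l)
    have := hΔ.coord_nonpos_of_not_isPos h' l
    rwa [root_smul, Equiv.reflection_smul, reflection_apply, map_sub, map_zsmul,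
      hΔ.coord_root_of_ne hl, smul_zero, sub_zero] at this
  obtain ⟨c, hc, hc'⟩ := hΔ.exists_eq_sum (hΔ.root_mem_span i)
  refine ⟨c k, ?_⟩
  rw [hc, Finsupp.sum, Finset.sum_eq_single k]
  · intro l _ hl
    have : c l = 0 := by simpa [key l hl] using (hc' l).symm
    rw [this, zero_smul]
  · intro h
    rw [Finsupp.notMem_support_iff.mp h, zero_smul]

end IsSimpleSet

end SimpleSet

end RootPairing

namespace RootPairing

namespace IsSimpleSet

variable {ι X Y : Type*} [AddCommGroup X] [AddCommGroup Y] {Ψ : RootDatum ι X Y} {Δ : Set ι}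
  (hΔ : IsSimpleSet Ψ Δ)

/-! ### Words in simple reflections and the exchange argument. -/

section Words

variable (Ψ) in
/-- The product of the simple reflections given by a word. -/
noncomputable def wordProd (L : List Δ) : Ψ.Aut := (L.map fun k ↦ Equiv.reflection Ψ (k : ι)).prod

@[simp] lemma wordProd_nil : wordProd Ψ ([] : List Δ) = 1 := rfl

@[simp] lemma wordProd_cons (k : Δ) (L : List Δ) :
    wordProd Ψ (k :: L) = Equiv.reflection Ψ (k : ι) * wordProd Ψ L := by
  simp [wordProd, -Equiv.mul_eq_comp]

lemma wordProd_append (L M : List Δ) :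
    wordProd Ψ (L ++ M) = wordProd Ψ L * wordProd Ψ M := by
  simp [wordProd, -Equiv.mul_eq_comp]

lemma wordProd_singleton (k : Δ) : wordProd Ψ [k] = Equiv.reflection Ψ (k : ι) := by
  simp [-Equiv.mul_eq_comp]

lemma wordProd_reverse (L : List Δ) : wordProd Ψ L.reverse = (wordProd Ψ L)⁻¹ := by
  induction L with
  | nil => simp
  | cons k L ih =>
    rw [List.reverse_cons, wordProd_append, ih, wordProd_singleton, wordProd_cons, mul_inv_rev,
      Equiv.reflection_inv]

variable [Finite ι]
include hΔ

/-- The exchange property. -/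
lemma exists_wordProd_mul_eq (a : Δ) (L : List Δ) (h : ¬ hΔ.IsPos (wordProd Ψ L • (a : ι))) :
    ∃ L' : List Δ, L'.length + 1 = L.length ∧
      wordProd Ψ L * Equiv.reflection Ψ (a : ι) = wordProd Ψ L' := by
  induction L with
  | nil => exact absurd (hΔ.isPos_simple a) (by simpa using h)
  | cons k T ih =>
    by_cases hT : hΔ.IsPos (wordProd Ψ T • (a : ι))
    -- Here the letter `k` turns the positive root `T • a` negative, so that root is a multiple of
    -- `k`. Thus conjugating the reflection in `a` by `T` gives the reflection in `k`, and both
    -- letters cancel.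
    · refine ⟨T, rfl, ?_⟩
      rw [wordProd_cons, mul_smul] at h
      obtain ⟨t, ht⟩ := hΔ.exists_eq_smul_of_not_isPos k hT h
      have := Ψ.reflection_eq_of_root_eq_smul ht
      rw [← conj_reflection] at this
      rw [wordProd_cons, ← this]
      simp only [mul_assoc, inv_mul_cancel_left, reflection_mul_self, mul_one]
    · obtain ⟨T', hT', hT''⟩ := ih hT
      exact ⟨k :: T', by simp [hT'], by rw [wordProd_cons, wordProd_cons, mul_assoc, hT'']⟩

/-- If the last letter is `a`, positivity of the image of `a` under the whole word makes its image
under the word without `a` negative; exchange then shortens the word by two. -/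
lemma wordProd_eq_one (L : List Δ) (h : ∀ i, hΔ.IsPos i → hΔ.IsPos (wordProd Ψ L • i)) :
    wordProd Ψ L = 1 := by
  induction hn : L.length using Nat.strong_induction_on generalizing L with
  | _ n ih =>
    rcases L.eq_nil_or_concat' with rfl | ⟨L₀, a, rfl⟩
    · simp
    · have h1 : wordProd Ψ (L₀ ++ [a]) = wordProd Ψ L₀ * Equiv.reflection Ψ (a : ι) := by
        rw [wordProd_append, wordProd_singleton]
      have h2 := hΔ.not_isPos_of_neg (j := wordProd Ψ L₀ • (a : ι)) (h a (hΔ.isPos_simple a)) (by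
        rw [h1, mul_smul, root_smul, root_smul, root_smul, Equiv.reflection_smul,
          reflection_apply_self, smul_neg, neg_neg])
      obtain ⟨L', hL', hL''⟩ := hΔ.exists_wordProd_mul_eq a L₀ h2
      rw [h1, hL'']
      refine ih L'.length ?_ L' (fun i hi ↦ ?_) rfl
      · simp at hn; omega
      · rw [← hL'', ← h1]
        exact h i hi

end Words

/-! ### Heights, and generation of the Weyl group by simple reflections. -/

section Height

variable [Finite ι]

/-- The height function of a set of simple roots. -/
noncomputable def height : X →ₗ[ℤ] ℚ :=
  letI := Fintype.ofFinite Δ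
  ∑ k, hΔ.coord k

lemma height_simple (k : Δ) : hΔ.height (Ψ.root k) = 1 := by
  let := Fintype.ofFinite Δ
  rw [height, LinearMap.sum_apply, Finset.sum_eq_single k]
  · exact hΔ.coord_root_self k
  · exact fun l _ hl ↦ hΔ.coord_root_of_ne hl
  · simp

lemma height_pos {i : ι} (h : hΔ.IsPos i) : 0 < hΔ.height (Ψ.root i) := by
  let := Fintype.ofFinite Δ
  rw [height, LinearMap.sum_apply]
  obtain ⟨k, hk⟩ := id h
  exact Finset.sum_pos' (fun l _ ↦ IsPos.coord_nonneg hΔ h l) ⟨k, Finset.mem_univ k, hk⟩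

lemma height_ne_zero (i : ι) : hΔ.height (Ψ.root i) ≠ 0 := by
  by_cases h : hΔ.IsPos i
  · exact (hΔ.height_pos h).ne'
  · have h1 : Ψ.root (Ψ.reflectionPerm i i) = -Ψ.root i := by simp
    have := hΔ.height_pos (hΔ.isPos_of_neg h h1)
    rw [h1, map_neg] at this
    linarith

include hΔ in
lemma exists_pairing_pos {i : ι} (h : hΔ.IsPos i) : ∃ k : Δ, 0 < Ψ.pairing i k := by
  let := Fintype.ofFinite ι
  obtain ⟨c, hc, hc'⟩ := hΔ.exists_eq_sum (hΔ.root_mem_span i)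
  have hpos := Ψ.rootForm_root_self_pos i
  nth_rw 1 [hc] at hpos
  rw [Finsupp.sum, map_sum, LinearMap.sum_apply] at hpos
  -- Expanding the first argument of (α, α) > 0 in simple roots, some term is positive; its
  -- coefficient is nonnegative, so the form value is positive too.
  obtain ⟨k, -, hk⟩ := Finset.exists_lt_of_sum_lt (s := c.support) (f := fun _ ↦ (0 : ℤ))
    (by simpa only [Finset.sum_const_zero, map_zsmul, LinearMap.smul_apply, smul_eq_mul] using hpos)
  refine ⟨k, ?_⟩
  have hck : 0 ≤ c k := by
    have := IsPos.coord_nonneg hΔ h k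
    rw [hc' k] at this
    exact_mod_cast this
  have h1 := pos_of_mul_pos_right hk hck
  have h2 := Ψ.rootForm_root_root k i
  have h3 := Ψ.rootForm_root_self_pos k
  by_contra! h4
  linarith [mul_nonpos_of_nonneg_of_nonpos h3.le h4]

variable (Ψ Δ) in
/-- The subgroup generated by the simple reflections. -/
noncomputable def simpleWeylGroup : Subgroup Ψ.Aut :=
  Subgroup.closure (Set.range fun k : Δ ↦ Equiv.reflection Ψ (k : ι))

/-- Induction on height: a simple reflection with positive pairing lowers the height by at least 1
and conjugates the reflection, unless the root is already a multiple of that simple root. -/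
lemma reflection_mem_of_isPos {i : ι} (h : hΔ.IsPos i) :
    Equiv.reflection Ψ i ∈ simpleWeylGroup Ψ Δ := by
  obtain ⟨n, hn⟩ := exists_nat_ge (hΔ.height (Ψ.root i))
  induction n generalizing i with
  | zero => exact absurd (hΔ.height_pos h) (by simpa using hn)
  | succ n ih =>
    obtain ⟨k, hk⟩ := hΔ.exists_pairing_pos h
    have hk' : Equiv.reflection Ψ (k : ι) ∈ simpleWeylGroup Ψ Δ :=
      Subgroup.subset_closure ⟨k, rfl⟩
    by_cases hi : hΔ.IsPos (Equiv.reflection Ψ (k : ι) • i)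
    · have := ih hi (by
        rw [root_smul, Equiv.reflection_smul, reflection_apply_root, map_sub, map_zsmul,
          height_simple, zsmul_eq_mul, mul_one]
        have : (1 : ℚ) ≤ Ψ.pairing i k := by exact_mod_cast hk
        push_cast at hn
        linarith)
      rw [← conj_reflection] at this
      rwa [Subgroup.mul_mem_cancel_right _ (inv_mem hk'), Subgroup.mul_mem_cancel_left _ hk']
        at this
    · obtain ⟨t, ht⟩ := hΔ.exists_eq_smul_of_not_isPos k h hi
      rwa [Ψ.reflection_eq_of_root_eq_smul ht]

include hΔ

lemma weylGroup_le_simpleWeylGroup : Ψ.weylGroup ≤ simpleWeylGroup Ψ Δ := by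
  rw [weylGroup, Subgroup.closure_le]
  rintro _ ⟨i, rfl⟩
  by_cases h : hΔ.IsPos i
  · exact hΔ.reflection_mem_of_isPos h
  · have h1 : Ψ.root (Ψ.reflectionPerm i i) = -Ψ.root i := by simp
    have h2 := Ψ.reflection_eq_of_root_eq_smul (h1.trans (neg_one_smul ℤ _).symm)
    rw [← h2]
    exact hΔ.reflection_mem_of_isPos (hΔ.isPos_of_neg h h1)

omit hΔ [Finite ι] in
lemma exists_wordProd_eq {w : Ψ.Aut} (hw : w ∈ simpleWeylGroup Ψ Δ) :
    ∃ L : List Δ, wordProd Ψ L = w := by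
  induction hw using Subgroup.closure_induction with
  | mem w hw =>
    obtain ⟨k, rfl⟩ := hw
    exact ⟨[k], wordProd_singleton k⟩
  | one => exact ⟨[], rfl⟩
  | mul v w _ _ hv hw =>
    obtain ⟨L, rfl⟩ := hv
    obtain ⟨M, rfl⟩ := hw
    exact ⟨L ++ M, wordProd_append L M⟩
  | inv w _ hw =>
    obtain ⟨L, rfl⟩ := hw
    exact ⟨L.reverse, wordProd_reverse L⟩

/-- An element of the Weyl group that preserves the positive roots is trivial. -/
lemma eq_one_of_isPos {w : Ψ.Aut} (hw : w ∈ Ψ.weylGroup)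
    (h : ∀ i, hΔ.IsPos i → hΔ.IsPos (w • i)) : w = 1 := by
  obtain ⟨L, rfl⟩ := exists_wordProd_eq (hΔ.weylGroup_le_simpleWeylGroup hw)
  exact hΔ.wordProd_eq_one L h

lemma height_smul {γ : Ψ.Aut} (hγ : ∀ i ∈ Δ, γ • i ∈ Δ) {x : X}
    (hx : x ∈ Submodule.span ℤ (Ψ.root '' Δ)) : hΔ.height (γ • x) = hΔ.height x := by
  induction hx using Submodule.span_induction with
  | mem x hx =>
    obtain ⟨k, hk, rfl⟩ := hx
    rw [← root_smul, hΔ.height_simple ⟨k, hk⟩, hΔ.height_simple ⟨_, hγ k hk⟩]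
  | zero => simp
  | add x y _ _ hx hy => rw [smul_add, map_add, map_add, hx, hy]
  | smul t x _ hx => rw [smul_comm, map_zsmul, map_zsmul, hx]

lemma height_root_smul {γ : Ψ.Aut} (hγ : ∀ i ∈ Δ, γ • i ∈ Δ) (i : ι) :
    hΔ.height (Ψ.root (γ • i)) = hΔ.height (Ψ.root i) := by
  rw [root_smul, hΔ.height_smul hγ (hΔ.root_mem_span i)]

lemma isPos_iff_height_pos {i : ι} : hΔ.IsPos i ↔ 0 < hΔ.height (Ψ.root i) := by
  refine ⟨hΔ.height_pos, fun h ↦ ?_⟩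
  by_contra h'
  have h1 : Ψ.root (Ψ.reflectionPerm i i) = -Ψ.root i := by simp
  have := hΔ.height_pos (hΔ.isPos_of_neg h' h1)
  rw [h1, map_neg] at this
  linarith

end Height

end IsSimpleSet

end RootPairing

namespace RootPairing

variable {ι X Y : Type*} [AddCommGroup X] [AddCommGroup Y] {Ψ : RootDatum ι X Y} {Δ : Set ι}
  {Γ : Subgroup Ψ.Aut}

/-! ### Geometry of `Γ`-orbits of roots. -/

section Orbits

variable (Ψ) in
lemma pairing_eq_zero_comm {i j : ι} : Ψ.pairing i j = 0 ↔ Ψ.pairing j i = 0 :=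
  Ψ.pairing_eq_zero_iff'

variable (Ψ) in
lemma isOrthogonal_iff {i j : ι} : Ψ.IsOrthogonal i j ↔ Ψ.pairing i j = 0 :=
  ⟨fun h ↦ h.1, fun h ↦ ⟨h, Ψ.pairing_eq_zero_comm.mp h⟩⟩

lemma sum_orbit_smul [Finite ι] {A : Type*} [AddCommMonoid A] (β : ι) (f : ι → A) (γ : Γ) :
    ∑ θ ∈ (Set.toFinite (MulAction.orbit Γ β)).toFinset, f (γ • θ) =
      ∑ θ ∈ (Set.toFinite (MulAction.orbit Γ β)).toFinset, f θ :=
  Finset.sum_equiv (MulAction.toPerm γ)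
    (fun i ↦ by
      simp only [Set.Finite.mem_toFinset, MulAction.toPerm_apply]
      exact ⟨MulAction.mem_orbit_of_mem_orbit γ,
        fun h ↦ by simpa using MulAction.mem_orbit_of_mem_orbit γ⁻¹ h⟩) (by simp)

lemma smul_sum_orbit_root [Finite ι] (β : ι) (γ : Γ) :
    γ • ∑ θ ∈ (Set.toFinite (MulAction.orbit Γ β)).toFinset, Ψ.root θ =
      ∑ θ ∈ (Set.toFinite (MulAction.orbit Γ β)).toFinset, Ψ.root θ := by
  rw [Finset.smul_sum, ← sum_orbit_smul β Ψ.root γ]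
  exact Finset.sum_congr rfl fun θ _ ↦ (Ψ.root_smul γ θ).symm

lemma restrict_smul (γ : Γ) (x : X) : restrict Ψ Γ (γ • x) = restrict Ψ Γ x := by
  have := Representation.Coinvariants.mk_self_apply (weightRep Ψ Γ) γ x
  exact congrArg (Submodule.torsion ℤ (weightRep Ψ Γ).Coinvariants).mkQ this

lemma restrict_root_smul (γ : Γ) (i : ι) :
    restrict Ψ Γ (Ψ.root (γ • i)) = restrict Ψ Γ (Ψ.root i) :=
  (congrArg _ (Ψ.root_smul γ i)).trans (restrict_smul γ (Ψ.root i))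

variable [Finite ι] (hΔ : IsSimpleSet Ψ Δ) (hΓ : ∀ γ ∈ Γ, ∀ i ∈ Δ, γ • i ∈ Δ)
include hΔ hΓ

lemma height_orbit {β θ : ι} (h : θ ∈ MulAction.orbit Γ β) :
    hΔ.height (Ψ.root θ) = hΔ.height (Ψ.root β) := by
  obtain ⟨γ, rfl⟩ := h
  exact hΔ.height_root_smul (hΓ γ γ.2) β

/-- Distinct roots in an orbit make obtuse angles. -/
lemma pairing_orbit_nonpos {β θ : ι} (h : θ ∈ MulAction.orbit Γ β) (hne : θ ≠ β) :
    Ψ.pairing θ β ≤ 0 := by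
  by_contra! hpos
  obtain ⟨k, hk⟩ := Ψ.root_sub_root_mem_of_pairingIn_pos (i := θ) (j := β)
    (by simpa using (Ψ.algebraMap_pairingIn ℤ θ β).trans_gt hpos) hne
  apply hΔ.height_ne_zero k
  rw [hk, map_sub, height_orbit hΔ hΓ h, sub_self]

/-- The orbit sum S has nonzero height, so (S, S) > 0. By invariance (S, S) is the orbit size times
(β, S), and (β, S) has the sign of the sum of pairings. -/
lemma sum_orbit_pairing_pos (β : ι) :
    0 < ∑ θ ∈ (Set.toFinite (MulAction.orbit Γ β)).toFinset, Ψ.pairing θ β := by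
  let := Fintype.ofFinite ι
  set O := (Set.toFinite (MulAction.orbit Γ β)).toFinset with hO
  have hβ : β ∈ O := by simp [hO]
  set S := ∑ θ ∈ O, Ψ.root θ with hS
  have h0 : S ≠ 0 := by
    intro h
    have h1 : hΔ.height S = O.card • hΔ.height (Ψ.root β) := by
      rw [hS, map_sum, ← Finset.sum_const]
      exact Finset.sum_congr rfl fun θ hθ ↦ height_orbit hΔ hΓ (by simpa [hO] using hθ)
    rw [h, map_zero] at h1
    have := hΔ.height_ne_zero β
    have : O.card ≠ 0 := Finset.card_ne_zero_of_mem hβ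
    simp_all
  have h1 : S ∈ Ψ.rootSpan ℤ := sum_mem fun θ _ ↦ Submodule.subset_span ⟨θ, rfl⟩
  have h2 := Ψ.rootForm_pos_of_ne_zero h1 h0
  have h3 : Ψ.RootForm S S = O.card • Ψ.RootForm (Ψ.root β) S := by
    have : Ψ.RootForm S S = ∑ θ ∈ O, Ψ.RootForm (Ψ.root θ) S := by
      conv_lhs => rw [hS, LinearMap.map_sum₂]
    rw [this, ← Finset.sum_const]
    refine Finset.sum_congr rfl fun θ hθ ↦ ?_
    obtain ⟨γ, rfl⟩ : θ ∈ MulAction.orbit Γ β := by simpa [hO] using hθ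
    have : γ • S = S := smul_sum_orbit_root β γ
    nth_rw 1 [← this]
    exact (congrArg (fun x ↦ Ψ.RootForm x (γ • S)) (Ψ.root_smul γ β)).trans
      (Ψ.rootForm_smul_smul γ (Ψ.root β) S)
  have h4 : 0 < Ψ.RootForm (Ψ.root β) S := by
    rw [h3] at h2
    exact (nsmul_pos_iff (Finset.card_ne_zero_of_mem hβ)).mp h2
  have h5 := Ψ.rootForm_root_self_mul β S
  have h6 : Ψ.toLinearMap S (Ψ.coroot β) = ∑ θ ∈ O, Ψ.pairing θ β := by
    simp [hS]
  rw [h6] at h5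
  have h7 := Ψ.rootForm_root_self_pos β
  by_contra! h8
  linarith [mul_nonpos_of_nonneg_of_nonpos h7.le h8]

/-- The pairings with β are 2 from β itself and nonpositive integers otherwise, with positive total:
there is room for only one -1. -/
lemma exists_partner {β : ι} (h : ¬ (MulAction.orbit Γ β).Pairwise Ψ.IsOrthogonal) :
    ∃ β' ∈ MulAction.orbit Γ β, β' ≠ β ∧ Ψ.pairing β' β = -1 ∧
      ∀ θ ∈ MulAction.orbit Γ β, θ ≠ β → θ ≠ β' → Ψ.pairing θ β = 0 := by
  classical
  obtain ⟨β', hβ', hne, hp⟩ : ∃ β' ∈ MulAction.orbit Γ β, β' ≠ β ∧ Ψ.pairing β' β ≠ 0 := by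
    simp only [Set.Pairwise, not_forall, isOrthogonal_iff] at h
    obtain ⟨θ', hθ', _, ⟨γ, rfl⟩, hne, hp⟩ := h
    refine ⟨γ⁻¹ • θ', MulAction.mem_orbit_of_mem_orbit _ hθ', ?_, ?_⟩
    · rintro h
      exact hne (by rw [← h]; simp)
    · intro h
      apply hp
      rw [← Ψ.pairing_smul_smul (γ : Ψ.Aut)] at h
      rw [← h]
      congr 1
      exact (smul_inv_smul γ θ').symm
  refine ⟨β', hβ', hne, ?_⟩
  have hsum := sum_orbit_pairing_pos hΔ hΓ β
  set O := (Set.toFinite (MulAction.orbit Γ β)).toFinset with hO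
  have hβO : β ∈ O := by simp [hO]
  have hβO' : β' ∈ O.erase β := by simp [hO, hne, hβ']
  rw [← Finset.add_sum_erase _ _ hβO, ← Finset.add_sum_erase _ _ hβO', pairing_same] at hsum
  have hle (θ) (hθ : θ ∈ (O.erase β).erase β') : Ψ.pairing θ β ≤ 0 := by
    simp only [Finset.mem_erase, hO, Set.Finite.mem_toFinset] at hθ
    exact pairing_orbit_nonpos hΔ hΓ hθ.2.2 hθ.2.1
  have h1 := Finset.sum_nonpos hle
  have h2 := pairing_orbit_nonpos hΔ hΓ hβ' hne
  refine ⟨by omega, fun θ hθ h3 h4 ↦ ?_⟩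
  have h5 : ∑ θ ∈ (O.erase β).erase β', Ψ.pairing θ β = 0 := by omega
  exact (Finset.sum_eq_zero_iff_of_nonpos hle).mp h5 θ (by simp [hO, hθ, h3, h4])

/-- The set `Ξ_β` is an orthogonal orbit, generated by a root whose restriction is a multiple of
that of `β`. -/
lemma exists_Xi_eq_orbit (β : ι) : ∃ (ξ : ι) (m : ℕ), Xi Ψ Γ β = MulAction.orbit Γ ξ ∧
    (MulAction.orbit Γ ξ).Pairwise Ψ.IsOrthogonal ∧
    (MulAction.orbit Γ β).ncard = m * (MulAction.orbit Γ ξ).ncard ∧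
    restrict Ψ Γ (Ψ.root ξ) = m • restrict Ψ Γ (Ψ.root β) := by
  classical
  by_cases h : (MulAction.orbit Γ β).Pairwise Ψ.IsOrthogonal
  · exact ⟨β, 1, by rw [Xi, if_pos h], h, by simp, by simp⟩
  have H (θ : ι) (hθ : θ ∈ MulAction.orbit Γ β) : ∃ θ' ∈ MulAction.orbit Γ β, θ' ≠ θ ∧
      Ψ.pairing θ' θ = -1 ∧ ∀ η ∈ MulAction.orbit Γ β, η ≠ θ → η ≠ θ' → Ψ.pairing η θ = 0 := by
    rw [← MulAction.orbit_eq_iff.mpr hθ] at h ⊢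
    exact exists_partner hΔ hΓ h
  choose! p hpO hpne hp hp' using H
  have hβ : β ∈ MulAction.orbit Γ β := MulAction.mem_orbit_self β
  have hpu {θ η : ι} (hθ : θ ∈ MulAction.orbit Γ β) (hη : η ∈ MulAction.orbit Γ β) (hne : η ≠ θ)
      (h0 : Ψ.pairing η θ ≠ 0) : η = p θ := by
    by_contra h1
    exact h0 (hp' θ hθ η hη hne h1)
  have hpp {θ : ι} (hθ : θ ∈ MulAction.orbit Γ β) : θ = p (p θ) := by
    refine hpu (hpO θ hθ) hθ (hpne θ hθ).symm ?_
    rw [Ne, ← pairing_eq_zero_comm, hp θ hθ]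
    norm_num
  -- Since `p θ` pairs to -1 with `θ`, this reflection is the root θ + `p θ`.
  let q (θ : ι) : ι := Ψ.reflectionPerm θ (p θ)
  have hq {θ : ι} (hθ : θ ∈ MulAction.orbit Γ β) :
      Ψ.root (q θ) = Ψ.root θ + Ψ.root (p θ) := by
    rw [root_reflectionPerm, reflection_apply_root, hp θ hθ]
    module
  have hpγ (γ : Γ) : γ • p β = p (γ • β) := by
    refine hpu (MulAction.mem_orbit _ _) (MulAction.mem_orbit_of_mem_orbit γ (hpO β hβ))
      (fun h ↦ hpne β hβ (MulAction.injective γ h)) ?_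
    have := Ψ.pairing_smul_smul γ (p β) β
    rw [hp β hβ] at this
    exact ne_of_eq_of_ne this (by norm_num)
  have hqγ (γ : Γ) : γ • q β = q (γ • β) := by
    apply Ψ.root.injective
    rw [hq (MulAction.mem_orbit _ _), ← hpγ]
    refine (Ψ.root_smul γ (q β)).trans ?_
    rw [hq hβ, smul_add, ← root_smul, ← root_smul]
    rfl
  have hqq {θ : ι} (hθ : θ ∈ MulAction.orbit Γ β) : q (p θ) = q θ := by
    apply Ψ.root.injective
    rw [hq hθ, hq (hpO θ hθ), ← hpp hθ, add_comm]
  have h0 {θ η : ι} (hθ : θ ∈ MulAction.orbit Γ β) (hη : η ∈ MulAction.orbit Γ β)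
      (h1 : η ≠ θ) (h2 : η ≠ p θ) : Ψ.pairing (q θ) η = 0 := by
    rw [pairing_eq_add_of_root_eq_add (hq hθ), hp' η hη θ hθ h1.symm, hp' η hη _ (hpO θ hθ) h2.symm,
      add_zero]
    · intro h3
      apply h1
      rw [hpp hη, ← h3, ← hpp hθ]
    · rintro rfl
      exact h2 (hpp hη)
  have hXi : Xi Ψ Γ β = MulAction.orbit Γ (q β) := by
    rw [Xi, if_neg h]
    ext ξ
    constructor
    · rintro ⟨_, ⟨γ, rfl⟩, θ', hθ', hne, hno, hξ⟩
      refine ⟨γ, Ψ.root.injective ?_⟩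
      rw [isOrthogonal_iff, pairing_eq_zero_comm] at hno
      rw [hξ, hpu (MulAction.mem_orbit β γ) hθ' hne hno, ← hq (MulAction.mem_orbit _ _), ← hqγ]
    · rintro ⟨γ, rfl⟩
      have hγ : γ • β ∈ MulAction.orbit Γ β := MulAction.mem_orbit _ _
      refine ⟨γ • β, hγ, p (γ • β), hpO _ hγ, hpne _ hγ, ?_, ?_⟩
      · rw [isOrthogonal_iff, pairing_eq_zero_comm, hp _ hγ]
        norm_num
      · rw [← hq hγ, ← hqγ]
  refine ⟨q β, 2, hXi, ?_, ?_, ?_⟩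
  · rintro _ ⟨γ, rfl⟩ _ ⟨δ, rfl⟩ hne
    simp only [hqγ] at hne ⊢
    have hγ : γ • β ∈ MulAction.orbit Γ β := MulAction.mem_orbit _ _
    have hδ : δ • β ∈ MulAction.orbit Γ β := MulAction.mem_orbit _ _
    have h1 : δ • β ≠ γ • β := fun h ↦ hne (by rw [h])
    have h2 : δ • β ≠ p (γ • β) := fun h ↦ hne (by rw [h, hqq hγ])
    rw [isOrthogonal_iff, pairing_eq_zero_comm, pairing_eq_add_of_root_eq_add (hq hδ),
      Ψ.pairing_eq_zero_comm.mp (h0 hγ hδ h1 h2),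
      Ψ.pairing_eq_zero_comm.mp (h0 hγ (hpO _ hδ) _ _), add_zero]
    · intro h
      exact h2 (by rw [← h, ← hpp hδ])
    · intro h
      exact h1 (by rw [hpp hδ, h, ← hpp hγ])
  -- The map `q` from the orbit of β onto the orbit of `q β` has fibres {θ, `p θ`}, whence the
  -- factor 2.
  · rw [Set.ncard_eq_toFinset_card _ (Set.toFinite _), Set.ncard_eq_toFinset_card _ (Set.toFinite _),
      Finset.card_eq_sum_card_fiberwise (f := q)
        (t := (Set.toFinite (MulAction.orbit Γ (q β))).toFinset), Finset.sum_const_nat (m := 2),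
      mul_comm]
    · intro ξ hξ
      obtain ⟨γ, rfl⟩ : ξ ∈ MulAction.orbit Γ (q β) := by simpa using hξ
      have hγ : γ • β ∈ MulAction.orbit Γ β := MulAction.mem_orbit _ _
      rw [Finset.card_eq_two]
      refine ⟨γ • β, p (γ • β), (hpne _ hγ).symm, ?_⟩
      ext η
      simp only [Finset.mem_filter, Set.Finite.mem_toFinset, Finset.mem_insert,
        Finset.mem_singleton, hqγ]
      constructor
      · rintro ⟨hη, hηq⟩
        by_contra! hne
        have h1 := h0 hγ hη hne.1 hne.2
        rw [← hηq, pairing_eq_add_of_root_eq_add (hq hη), hp η hη, pairing_same] at h1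
        norm_num at h1
      · rintro (rfl | rfl)
        · exact ⟨hγ, rfl⟩
        · exact ⟨hpO _ hγ, hqq hγ⟩
    · rintro θ hθ
      obtain ⟨γ, rfl⟩ : θ ∈ MulAction.orbit Γ β := by simpa using hθ
      simp [← hqγ]
  · rw [hq hβ, map_add, two_nsmul]
    obtain ⟨γ, hγ⟩ := hpO β hβ
    rw [← hγ]
    congr 1
    exact restrict_root_smul γ β

end Orbits

end RootPairing

namespace RootPairing

variable {ι X Y : Type*} [AddCommGroup X] [AddCommGroup Y] {Ψ : RootDatum ι X Y} {Δ : Set ι}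
  {Γ : Subgroup Ψ.Aut}

/-! ### The two lattices and their perfect pairing. -/

section Lattices

variable (Ψ Γ)

lemma restrict_surjective : Function.Surjective (restrict Ψ Γ) :=
  (Submodule.mkQ_surjective _).comp (Representation.Coinvariants.mk_surjective _)

instance finite_restrictedWeight [Module.Finite ℤ X] : Module.Finite ℤ (RestrictedWeight Ψ Γ) :=
  .of_surjective _ (restrict_surjective Ψ Γ)

instance free_restrictedWeight [Module.Finite ℤ X] : Module.Free ℤ (RestrictedWeight Ψ Γ) :=
  inferInstance

lemma finite_fixedCoweight [Module.Finite ℤ Y] : Module.Finite ℤ (fixedCoweight Ψ Γ) :=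
  inferInstance

lemma free_fixedCoweight [Module.Finite ℤ Y] : Module.Free ℤ (fixedCoweight Ψ Γ) :=
  have := Ψ.isAddTorsionFree_right
  inferInstance

variable {Ψ Γ} in
lemma toLinearMap_smul_fixed (γ : Γ) (x : X) (y : fixedCoweight Ψ Γ) :
    Ψ.toLinearMap (γ • x) (y : Y) = Ψ.toLinearMap x (y : Y) :=
  (Ψ.toLinearMap_smul γ x y).trans (congrArg _ (y.2 γ γ.2))

lemma torsion_le_ker {A B : Type*} [AddCommGroup A] [AddCommGroup B] [IsAddTorsionFree B]
    (f : A →ₗ[ℤ] B) : Submodule.torsion ℤ A ≤ LinearMap.ker f := by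
  intro x hx
  obtain ⟨n, hn⟩ := (Submodule.mem_torsion_iff x).mp hx
  have h1 : (n : ℤ) • f x = 0 := by
    rw [← map_zsmul]
    exact (congrArg f hn).trans (map_zero f)
  exact (smul_eq_zero_iff_right (nonZeroDivisors.ne_zero n.2)).mp h1

variable {Ψ Γ} in
/-- A `Γ`-invariant map to a torsion-free group factors through the restriction map. -/
noncomputable def restrictLift {B : Type*} [AddCommGroup B] [IsAddTorsionFree B] (f : X →ₗ[ℤ] B)
    (hf : ∀ (γ : Γ) (x : X), f (γ • x) = f x) : RestrictedWeight Ψ Γ →ₗ[ℤ] B :=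
  (Submodule.torsion ℤ (weightRep Ψ Γ).Coinvariants).liftQ
    (Representation.Coinvariants.lift (weightRep Ψ Γ) f fun γ ↦ LinearMap.ext (hf γ))
    (torsion_le_ker _)

/-- The pairing between coinvariants and invariants. -/
noncomputable def restrictedPairing : RestrictedWeight Ψ Γ →ₗ[ℤ] fixedCoweight Ψ Γ →ₗ[ℤ] ℤ :=
  have : IsAddTorsionFree (fixedCoweight Ψ Γ →ₗ[ℤ] ℤ) := .of_isTorsionFree ℤ _
  restrictLift (Ψ.toLinearMap.domRestrict₂ (fixedCoweight Ψ Γ))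
    fun γ x ↦ LinearMap.ext fun y ↦ toLinearMap_smul_fixed γ x y

@[simp] lemma restrictedPairing_restrict (x : X) (y : fixedCoweight Ψ Γ) :
    restrictedPairing Ψ Γ (restrict Ψ Γ x) y = Ψ.toLinearMap x (y : Y) :=
  rfl

/-- Functionals on the restricted lattice are the `Γ`-invariant functionals on `X`, that is, the
fixed elements of `Y`. The other direction of perfectness follows from reflexivity of the restricted
lattice. -/
instance isPerfPair_restrictedPairing [Module.Finite ℤ X] :
    (restrictedPairing Ψ Γ).IsPerfPair := by
  refine LinearMap.IsPerfPair.flip (p := (restrictedPairing Ψ Γ).flip) (.of_bijective _ ⟨fun y z h ↦ ?_, fun f ↦ ?_⟩)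
  · exact Subtype.ext (Ψ.eq_of_forall_toLinearMap_eq fun x ↦
      LinearMap.congr_fun h (restrict Ψ Γ x))
  · obtain ⟨y, hy⟩ := (LinearMap.IsPerfPair.bijective_right Ψ.toLinearMap).2 (f ∘ₗ restrict Ψ Γ)
    have hy' (x : X) : Ψ.toLinearMap x y = f (restrict Ψ Γ x) := LinearMap.congr_fun hy x
    refine ⟨⟨y, fun γ hγ ↦ Ψ.eq_of_forall_toLinearMap_eq fun x ↦ ?_⟩, LinearMap.ext fun a ↦ ?_⟩
    · rw [← toLinearMap_smul, hy', hy']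
      exact congrArg f (restrict_smul ⟨γ, hγ⟩ x)
    · obtain ⟨x, rfl⟩ := restrict_surjective Ψ Γ a
      exact hy' x

variable {Ψ Γ} in
lemma toLinearMap_eq_of_restrict_eq {x x' : X} (h : restrict Ψ Γ x = restrict Ψ Γ x')
    (y : fixedCoweight Ψ Γ) : Ψ.toLinearMap x (y : Y) = Ψ.toLinearMap x' (y : Y) := by
  rw [← restrictedPairing_restrict, h, restrictedPairing_restrict]

end Lattices

/-! ### The norm map as a model of restriction inside `X`. -/

section Norm

variable [Fintype Γ]

variable (Ψ Γ) in
/-- The norm map `x ↦ ∑ γ, γ • x`. -/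
noncomputable def normMap : X →ₗ[ℤ] X := ∑ γ : Γ, weightRep Ψ Γ γ

lemma normMap_apply (x : X) : normMap Ψ Γ x = ∑ γ : Γ, γ • x := by
  rw [normMap, LinearMap.sum_apply]
  rfl

lemma normMap_smul (γ : Γ) (x : X) : normMap Ψ Γ (γ • x) = normMap Ψ Γ x := by
  simp only [normMap_apply, smul_smul]
  exact Fintype.sum_equiv (Equiv.mulRight γ) _ _ fun _ ↦ rfl

lemma normMap_of_fixed {x : X} (h : ∀ γ : Γ, γ • x = x) :
    normMap Ψ Γ x = Fintype.card Γ • x := by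
  simp [normMap_apply, h]

lemma restrict_normMap (x : X) :
    restrict Ψ Γ (normMap Ψ Γ x) = Fintype.card Γ • restrict Ψ Γ x := by
  simp [normMap_apply, restrict_smul]

lemma toLinearMap_normMap (x : X) (y : fixedCoweight Ψ Γ) :
    Ψ.toLinearMap (normMap Ψ Γ x) (y : Y) = Fintype.card Γ • Ψ.toLinearMap x (y : Y) := by
  simp [normMap_apply, toLinearMap_smul_fixed]

/-- The norm factors through restriction because `X` is torsion-free, and restricting a norm
multiplies by |Γ|. Questions about restricted weights thus move into `X`, where the invariant form
is available. -/
lemma restrict_eq_zero_iff {x : X} : restrict Ψ Γ x = 0 ↔ normMap Ψ Γ x = 0 := by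
  have := Ψ.isAddTorsionFree_left
  constructor
  · intro h
    exact (congrArg (restrictLift (normMap Ψ Γ) normMap_smul) h).trans (map_zero _)
  · intro h
    have h1 := restrict_normMap (Ψ := Ψ) (Γ := Γ) x
    rw [h, map_zero, ← natCast_zsmul] at h1
    exact (smul_eq_zero_iff_right (by simp)).mp h1.symm

lemma restrict_eq_iff {x x' : X} :
    restrict Ψ Γ x = restrict Ψ Γ x' ↔ normMap Ψ Γ x = normMap Ψ Γ x' := by
  rw [← sub_eq_zero, ← map_sub, restrict_eq_zero_iff, map_sub, sub_eq_zero]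

lemma normMap_root_mem (i : ι) : normMap Ψ Γ (Ψ.root i) ∈ Ψ.rootSpan ℤ := by
  rw [normMap_apply]
  exact sum_mem fun γ _ ↦ Submodule.subset_span ⟨γ • i, Ψ.root_smul γ i⟩

lemma normMap_smul_of_mem {w : Ψ.Aut} (hw : w ∈ fixedWeylGroup Ψ Γ) (x : X) :
    normMap Ψ Γ (w • x) = w • normMap Ψ Γ x := by
  simp only [normMap_apply, Finset.smul_sum]
  refine Finset.sum_congr rfl fun γ _ ↦ ?_
  have : (γ : Ψ.Aut) * w = w * γ := mul_inv_eq_iff_eq_mul.mp (hw.2 γ γ.2)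
  have h1 := congrArg (· • x) this
  simp only [mul_smul] at h1
  exact h1

lemma card_nsmul_normMap_root [Finite ι] (β : ι) :
    (MulAction.orbit Γ β).ncard • normMap Ψ Γ (Ψ.root β) =
      Fintype.card Γ • ∑ θ ∈ (Set.toFinite (MulAction.orbit Γ β)).toFinset, Ψ.root θ := by
  rw [← normMap_of_fixed (smul_sum_orbit_root β), map_sum,
    Set.ncard_eq_toFinset_card _ (Set.toFinite _), ← Finset.sum_const]
  refine Finset.sum_congr rfl fun θ hθ ↦ ?_
  obtain ⟨γ, rfl⟩ : θ ∈ MulAction.orbit Γ β := by simpa using hθ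
  exact ((congrArg (normMap Ψ Γ) (Ψ.root_smul γ β)).trans (normMap_smul γ _)).symm

end Norm

end RootPairing

namespace RootPairing

variable {ι X Y : Type*} [AddCommGroup X] [AddCommGroup Y] {Ψ : RootDatum ι X Y} {Δ : Set ι}
  {Γ : Subgroup Ψ.Aut}

/-! ### Restricted coroots and reflections. -/

section Coroots

variable [Finite ι]

/-- The sum of the coroots in an orbit, as a fixed element. -/
noncomputable def orbitCoroot (Ψ : RootDatum ι X Y) (Γ : Subgroup Ψ.Aut) (ξ : ι) :
    fixedCoweight Ψ Γ :=
  ⟨∑ θ ∈ (Set.toFinite (MulAction.orbit Γ ξ)).toFinset, Ψ.coroot θ, fun γ hγ ↦ by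
    conv_lhs => rw [← sum_orbit_smul ξ Ψ.coroot ⟨γ, hγ⟩, map_sum]
    exact Finset.sum_congr rfl fun θ _ ↦ Ψ.coweightMap_coroot_smul γ θ⟩

lemma toLinearMap_orbitCoroot (ξ : ι) (x : X) :
    Ψ.toLinearMap x (orbitCoroot Ψ Γ ξ : Y) =
      ∑ θ ∈ (Set.toFinite (MulAction.orbit Γ ξ)).toFinset, Ψ.toLinearMap x (Ψ.coroot θ) :=
  map_sum _ _ _

lemma toLinearMap_root_orbitCoroot {ξ : ι}
    (h : (MulAction.orbit Γ ξ).Pairwise Ψ.IsOrthogonal) {θ : ι} (hθ : θ ∈ MulAction.orbit Γ ξ) :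
    Ψ.toLinearMap (Ψ.root θ) (orbitCoroot Ψ Γ ξ : Y) = 2 := by
  rw [toLinearMap_orbitCoroot, Finset.sum_eq_single θ]
  · exact Ψ.root_coroot_two θ
  · intro η hη hne
    exact (h hθ (by simpa using hη) hne.symm).1
  · intro h
    simp [hθ] at h

-- Each new root is annihilated by the coroots already treated, so the product of reflections has no
-- cross terms.
omit [Finite ι] in
lemma exists_weylGroup_prod (s : Finset ι) (h : (s : Set ι).Pairwise Ψ.IsOrthogonal) :
    ∃ w ∈ Ψ.weylGroup, ∀ x : X,
      w • x = x - ∑ θ ∈ s, Ψ.toLinearMap x (Ψ.coroot θ) • Ψ.root θ := by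
  classical
  induction s using Finset.induction_on with
  | empty => exact ⟨1, one_mem _, by simp⟩
  | insert i s hi ih =>
    obtain ⟨w, hw, hw'⟩ := ih (h.mono (by simp))
    refine ⟨w * Equiv.reflection Ψ i, mul_mem hw (Ψ.reflection_mem_weylGroup i), fun x ↦ ?_⟩
    rw [mul_smul, Equiv.reflection_smul, hw', Finset.sum_insert hi, reflection_apply, ← sub_sub]
    congr 1
    refine Finset.sum_congr rfl fun θ hθ ↦ ?_
    have : Ψ.pairing i θ = 0 :=
      (h (by simp) (by simp [hθ]) (ne_of_mem_of_not_mem hθ hi).symm).1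
    simp [this]

/-- The product of the reflections in an orthogonal orbit belongs to `W^Γ`. -/
lemma exists_fixedWeylGroup_prod {ξ : ι} (h : (MulAction.orbit Γ ξ).Pairwise Ψ.IsOrthogonal) :
    ∃ w ∈ fixedWeylGroup Ψ Γ, ∀ x : X,
      w • x = x - ∑ θ ∈ (Set.toFinite (MulAction.orbit Γ ξ)).toFinset,
        Ψ.toLinearMap x (Ψ.coroot θ) • Ψ.root θ := by
  obtain ⟨w, hw, hw'⟩ := exists_weylGroup_prod (Ψ := Ψ)
    (Set.toFinite (MulAction.orbit Γ ξ)).toFinset (by simpa using h)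
  refine ⟨w, ⟨hw, fun γ hγ ↦ aut_ext fun x ↦ ?_⟩, hw'⟩
  rw [mul_smul, mul_smul, hw', hw', smul_sub, smul_inv_smul, Finset.smul_sum]
  congr 1
  rw [← sum_orbit_smul ξ (fun θ ↦ Ψ.toLinearMap x (Ψ.coroot θ) • Ψ.root θ) ⟨γ, hγ⟩]
  refine Finset.sum_congr rfl fun θ _ ↦ ?_
  change γ • Ψ.toLinearMap (γ⁻¹ • x) (Ψ.coroot θ) • Ψ.root θ =
    Ψ.toLinearMap x (Ψ.coroot (γ • θ)) • Ψ.root (γ • θ)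
  rw [smul_comm, root_smul, ← toLinearMap_smul_coroot_smul, smul_inv_smul]

/-- The coroot of the restriction of a root `β`. -/
noncomputable def restrictedCoroot (Ψ : RootDatum ι X Y) (Γ : Subgroup Ψ.Aut) (β : ι) : Y :=
  ((MulAction.orbit Γ β).ncard / (Xi Ψ Γ β).ncard) • ∑ᶠ ξ ∈ Xi Ψ Γ β, Ψ.coroot ξ

lemma orbit_ncard_pos (ξ : ι) : 0 < (MulAction.orbit Γ ξ).ncard :=
  (Set.ncard_pos (Set.toFinite _)).mpr ⟨ξ, MulAction.mem_orbit_self ξ⟩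

lemma restrictedCoroot_eq {β ξ : ι} {m : ℕ} (hXi : Xi Ψ Γ β = MulAction.orbit Γ ξ)
    (hm : (MulAction.orbit Γ β).ncard = m * (MulAction.orbit Γ ξ).ncard) :
    restrictedCoroot Ψ Γ β = m • (orbitCoroot Ψ Γ ξ : Y) := by
  rw [restrictedCoroot, hXi, hm, Nat.mul_div_cancel _ (orbit_ncard_pos ξ),
    finsum_mem_eq_finite_toFinset_sum _ (Set.toFinite _)]
  rfl

variable (hΔ : IsSimpleSet Ψ Δ) (hΓ : ∀ γ ∈ Γ, ∀ i ∈ Δ, γ • i ∈ Δ)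
include hΔ hΓ

lemma ncard_Xi_dvd (β : ι) : (Xi Ψ Γ β).ncard ∣ (MulAction.orbit Γ β).ncard := by
  obtain ⟨ξ, m, hXi, -, hm, -⟩ := exists_Xi_eq_orbit hΔ hΓ β
  rw [hm, hXi]
  exact dvd_mul_left _ _

lemma restrictedCoroot_mem (β : ι) : restrictedCoroot Ψ Γ β ∈ fixedCoweight Ψ Γ := by
  obtain ⟨ξ, m, hXi, -, hm, -⟩ := exists_Xi_eq_orbit hΔ hΓ β
  rw [restrictedCoroot_eq hXi hm]
  exact nsmul_mem (orbitCoroot Ψ Γ ξ).2 m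

lemma toLinearMap_root_restrictedCoroot_self (β : ι) :
    Ψ.toLinearMap (Ψ.root β) (restrictedCoroot Ψ Γ β) = 2 := by
  obtain ⟨ξ, m, hXi, ho, hm, hr⟩ := exists_Xi_eq_orbit hΔ hΓ β
  rw [restrictedCoroot_eq hXi hm, map_nsmul, ← LinearMap.smul_apply, ← map_nsmul,
    ← toLinearMap_root_orbitCoroot ho (MulAction.mem_orbit_self ξ)]
  exact toLinearMap_eq_of_restrict_eq (by rw [map_nsmul, hr]) _

lemma exists_restrict_smul_eq (β : ι) : ∃ w ∈ fixedWeylGroup Ψ Γ, ∀ x : X,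
    restrict Ψ Γ (w • x) = restrict Ψ Γ x -
      Ψ.toLinearMap x (restrictedCoroot Ψ Γ β) • restrict Ψ Γ (Ψ.root β) := by
  obtain ⟨ξ, m, hXi, ho, hm, hr⟩ := exists_Xi_eq_orbit hΔ hΓ β
  obtain ⟨w, hw, hw'⟩ := exists_fixedWeylGroup_prod ho
  refine ⟨w, hw, fun x ↦ ?_⟩
  rw [hw', map_sub, map_sum, restrictedCoroot_eq hXi hm, map_nsmul, toLinearMap_orbitCoroot,
    smul_assoc, smul_comm, ← hr, Finset.sum_smul]
  congr 1
  refine Finset.sum_congr rfl fun θ hθ ↦ ?_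
  obtain ⟨γ, rfl⟩ : θ ∈ MulAction.orbit Γ ξ := by simpa using hθ
  rw [map_zsmul]
  exact congrArg _ (restrict_root_smul γ ξ)

/-- The restricted coroots in terms of the invariant form. -/
lemma rootForm_normMap_mul [Fintype ι] [Fintype Γ] (β : ι) (x : X) :
    Ψ.RootForm (normMap Ψ Γ (Ψ.root β)) (Ψ.root β) *
      Ψ.toLinearMap x (restrictedCoroot Ψ Γ β) =
    2 * Ψ.RootForm (normMap Ψ Γ (Ψ.root β)) x ∧
    Ψ.RootForm (normMap Ψ Γ (Ψ.root β)) (Ψ.root β) ≠ 0 := by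
  obtain ⟨ξ, m, hXi, ho, hm, hr⟩ := exists_Xi_eq_orbit hΔ hΓ β
  set n := (MulAction.orbit Γ ξ).ncard with hn
  set q := Ψ.RootForm (Ψ.root ξ) (Ψ.root ξ) with hq
  have h1 (x : X) : q * Ψ.toLinearMap x (orbitCoroot Ψ Γ ξ : Y) = 2 * Ψ.RootForm
      (∑ θ ∈ (Set.toFinite (MulAction.orbit Γ ξ)).toFinset, Ψ.root θ) x := by
    rw [toLinearMap_orbitCoroot, LinearMap.map_sum₂, Finset.mul_sum, Finset.mul_sum]
    refine Finset.sum_congr rfl fun θ hθ ↦ ?_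
    obtain ⟨γ, rfl⟩ : θ ∈ MulAction.orbit Γ ξ := by simpa using hθ
    rw [← rootForm_root_self_mul, hq]
    congr 1
    rw [← Ψ.rootForm_smul_smul γ, ← root_smul]
    rfl
  have h2 : normMap Ψ Γ (Ψ.root ξ) = m • normMap Ψ Γ (Ψ.root β) := by
    rw [← map_nsmul, ← restrict_eq_iff, map_nsmul, hr]
  have h3 := card_nsmul_normMap_root (Ψ := Ψ) (Γ := Γ) ξ
  rw [h2, ← hn] at h3
  have h4 (x : X) : (Fintype.card Γ * q) * Ψ.toLinearMap x (restrictedCoroot Ψ Γ β) =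
      (n * m * m) * (2 * Ψ.RootForm (normMap Ψ Γ (Ψ.root β)) x) := by
    have h5 := congrArg (fun z ↦ Ψ.RootForm z x) h3
    simp only [map_nsmul, LinearMap.smul_apply, nsmul_eq_mul] at h5
    rw [restrictedCoroot_eq hXi hm, map_nsmul, nsmul_eq_mul]
    linear_combination (Fintype.card Γ * m : ℤ) * h1 x - 2 * m * h5
  have h5 : (Fintype.card Γ * q : ℤ) ≠ 0 :=
    mul_ne_zero (by simp) (Ψ.rootForm_root_self_pos ξ).ne'
  -- Evaluation at β, where the coroot takes the value 2, identifies the constant in `h4`.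
  have h6 := h4 (Ψ.root β)
  rw [toLinearMap_root_restrictedCoroot_self hΔ hΓ] at h6
  have h7 : (Fintype.card Γ * q : ℤ) =
      (n * m * m) * Ψ.RootForm (normMap Ψ Γ (Ψ.root β)) (Ψ.root β) := by linarith
  rw [h7] at h5
  refine ⟨mul_left_cancel₀ (left_ne_zero_of_mul h5) ?_, right_ne_zero_of_mul h5⟩
  linear_combination h4 x - Ψ.toLinearMap x (restrictedCoroot Ψ Γ β) * h7

variable [Finite Γ]

/-- In 2(Nβ, x)/(Nβ, β) the numerator depends only on the restriction. The denominators agree since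
β' also pairs to 2 with the coroot of β, which gives (Nβ, β) = (Nβ, β'). -/
lemma restrictedCoroot_eq_of_restrict_eq {β β' : ι}
    (h : restrict Ψ Γ (Ψ.root β) = restrict Ψ Γ (Ψ.root β')) :
    restrictedCoroot Ψ Γ β = restrictedCoroot Ψ Γ β' := by
  let := Fintype.ofFinite ι
  let := Fintype.ofFinite Γ
  refine Ψ.eq_of_forall_toLinearMap_eq fun x ↦ ?_
  have hN := restrict_eq_iff.mp h
  have h1 := rootForm_normMap_mul hΔ hΓ β
  have h2 := rootForm_normMap_mul hΔ hΓ β'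
  have h3 := (h1 (Ψ.root β')).1
  rw [← toLinearMap_eq_of_restrict_eq h ⟨_, restrictedCoroot_mem hΔ hΓ β⟩,
    toLinearMap_root_restrictedCoroot_self hΔ hΓ] at h3
  refine mul_left_cancel₀ (h1 x).2 ?_
  rw [(h1 x).1, hN, ← (h2 x).1, ← hN]
  congr 1
  linarith

/-- Equal coroots make Nβ and Nβ' proportional, by nondegeneracy of the form on the root span. Both
pair to 2|Γ| with the common coroot, so they are equal. -/
lemma restrict_eq_of_restrictedCoroot_eq {β β' : ι}
    (h : restrictedCoroot Ψ Γ β = restrictedCoroot Ψ Γ β') :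
    restrict Ψ Γ (Ψ.root β) = restrict Ψ Γ (Ψ.root β') := by
  let := Fintype.ofFinite ι
  let := Fintype.ofFinite Γ
  have := Ψ.isAddTorsionFree_left
  have h1 := rootForm_normMap_mul hΔ hΓ β
  have h2 := rootForm_normMap_mul hΔ hΓ β'
  set c := Ψ.RootForm (normMap Ψ Γ (Ψ.root β)) (Ψ.root β)
  set c' := Ψ.RootForm (normMap Ψ Γ (Ψ.root β')) (Ψ.root β')
  have h3 : c' • normMap Ψ Γ (Ψ.root β) = c • normMap Ψ Γ (Ψ.root β') := by
    rw [← sub_eq_zero]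
    have hx (x : X) :
        Ψ.RootForm (c' • normMap Ψ Γ (Ψ.root β) - c • normMap Ψ Γ (Ψ.root β')) x = 0 := by
      have h3 := (h1 x).1
      have h4 := (h2 x).1
      rw [← h] at h4
      simp only [map_sub, map_zsmul, LinearMap.sub_apply, LinearMap.smul_apply, smul_eq_mul]
      refine mul_left_cancel₀ (two_ne_zero (α := ℤ)) ?_
      linear_combination c * h4 - c' * h3
    exact Ψ.eq_zero_of_mem_rootSpan_of_rootForm_self_eq_zero (sub_mem
      (Submodule.smul_mem _ _ (normMap_root_mem β)) (Submodule.smul_mem _ _ (normMap_root_mem β')))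
      (hx _)
  have h4 := congrArg (fun x ↦ Ψ.toLinearMap x (restrictedCoroot Ψ Γ β)) h3
  have h5 := toLinearMap_normMap (Ψ.root β) ⟨_, restrictedCoroot_mem hΔ hΓ β⟩
  have h6 := toLinearMap_normMap (Ψ.root β') ⟨_, restrictedCoroot_mem hΔ hΓ β⟩
  simp only [nsmul_eq_mul] at h5 h6
  rw [toLinearMap_root_restrictedCoroot_self hΔ hΓ] at h5
  rw [h, toLinearMap_root_restrictedCoroot_self hΔ hΓ, ← h] at h6
  simp only [map_zsmul, LinearMap.smul_apply, smul_eq_mul, h5, h6] at h4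
  have h7 : c' = c := mul_right_cancel₀ (by simp) h4
  rw [h7] at h3
  rw [restrict_eq_iff]
  exact smul_right_injective X (h1 0).2 h3

lemma toLinearMap_smul_restrictedCoroot_smul {w : Ψ.Aut} (hw : w ∈ fixedWeylGroup Ψ Γ) (β : ι)
    (x : X) : Ψ.toLinearMap (w • x) (restrictedCoroot Ψ Γ (w • β)) =
      Ψ.toLinearMap x (restrictedCoroot Ψ Γ β) := by
  let := Fintype.ofFinite ι
  let := Fintype.ofFinite Γ
  have h1 := rootForm_normMap_mul hΔ hΓ β x
  have h2 := rootForm_normMap_mul hΔ hΓ (w • β) (w • x)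
  rw [root_smul, normMap_smul_of_mem hw, rootForm_smul_smul, rootForm_smul_smul] at h2
  exact mul_left_cancel₀ h1.2 (h2.1.trans h1.1.symm)

/-- The restricted roots and coroots are stable under the restricted reflections. -/
lemma exists_restrict_root_eq (β β' : ι) : ∃ η,
    restrict Ψ Γ (Ψ.root η) = restrict Ψ Γ (Ψ.root β') -
      Ψ.toLinearMap (Ψ.root β') (restrictedCoroot Ψ Γ β) • restrict Ψ Γ (Ψ.root β) ∧
    restrictedCoroot Ψ Γ η = restrictedCoroot Ψ Γ β' -
      Ψ.toLinearMap (Ψ.root β) (restrictedCoroot Ψ Γ β') • restrictedCoroot Ψ Γ β := by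
  obtain ⟨w, hw, hw'⟩ := exists_restrict_smul_eq hΔ hΓ β
  refine ⟨w • β', by rw [root_smul, hw'], Ψ.eq_of_forall_toLinearMap_eq fun x ↦ ?_⟩
  -- Testing on `w • x` allows the equivariance of coroots to remove `w` from the left-hand side.
  obtain ⟨x, rfl⟩ := MulAction.surjective w x
  have key (i : ι) : Ψ.toLinearMap (w • x) (restrictedCoroot Ψ Γ i) =
      Ψ.toLinearMap x (restrictedCoroot Ψ Γ i) - Ψ.toLinearMap x (restrictedCoroot Ψ Γ β) *
        Ψ.toLinearMap (Ψ.root β) (restrictedCoroot Ψ Γ i) := by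
    rw [← smul_eq_mul, ← LinearMap.smul_apply, ← map_zsmul, ← LinearMap.sub_apply, ← map_sub]
    refine toLinearMap_eq_of_restrict_eq ?_ ⟨_, restrictedCoroot_mem hΔ hΓ i⟩
    rw [hw', map_sub, map_zsmul]
  rw [toLinearMap_smul_restrictedCoroot_smul hΔ hΓ hw, map_sub, map_zsmul, key, key,
    toLinearMap_root_restrictedCoroot_self hΔ hΓ, smul_eq_mul]
  ring

end Coroots

/-! ### Faithfulness of W^Γ on restricted weights. -/

section Faithful

variable [Finite ι] [Finite Γ]

/-- The action of `W^Γ` on the restricted weights is faithful. -/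
lemma eq_of_restrict_smul_eq (hΔ : IsSimpleSet Ψ Δ) (hΓ : ∀ γ ∈ Γ, ∀ i ∈ Δ, γ • i ∈ Δ)
    {v w : Ψ.Aut} (hv : v ∈ fixedWeylGroup Ψ Γ) (hw : w ∈ fixedWeylGroup Ψ Γ)
    (h : ∀ x : X, restrict Ψ Γ (v • x) = restrict Ψ Γ (w • x)) : v = w := by
  let := Fintype.ofFinite Γ
  have hu := mul_mem (inv_mem hw) hv
  rw [← inv_mul_eq_one, ← inv_inj, mul_inv_rev, inv_inv, inv_one]
  refine hΔ.eq_one_of_isPos (mul_mem (inv_mem hw.1) hv.1) fun i hi ↦ ?_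
  -- The norm of a root has |Γ| times its height, so equality of norms shows that `w⁻¹ * v`
  -- preserves heights of roots.
  have h1 : normMap Ψ Γ (Ψ.root ((w⁻¹ * v) • i)) = normMap Ψ Γ (Ψ.root i) := by
    rw [root_smul, mul_smul, normMap_smul_of_mem (inv_mem hw), restrict_eq_iff.mp (h _),
      normMap_smul_of_mem hw, inv_smul_smul]
  have h2 (i : ι) : hΔ.height (normMap Ψ Γ (Ψ.root i)) =
      Fintype.card Γ * hΔ.height (Ψ.root i) := by
    rw [normMap_apply, map_sum, Finset.sum_congr rfl (g := fun _ ↦ hΔ.height (Ψ.root i))]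
    · simp
    · intro γ _
      rw [← hΔ.height_root_smul (hΓ γ γ.2) i, root_smul]
      rfl
  have h3 := congrArg hΔ.height h1
  rw [h2, h2] at h3
  rw [hΔ.isPos_iff_height_pos] at hi ⊢
  rwa [mul_left_cancel₀ (by simp) h3]

end Faithful

end RootPairing

/-! ### The restricted root datum and its Weyl group. -/

namespace RootPairing

variable {ι X Y : Type*} [AddCommGroup X] [AddCommGroup Y] {Ψ : RootDatum ι X Y} {Δ : Set ι}
  {Γ : Subgroup Ψ.Aut}

/-- A root with a given restriction. -/
noncomputable def rootLift (α : restrictedRoots Ψ Γ) : ι := α.2.choose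

lemma restrict_rootLift (α : restrictedRoots Ψ Γ) :
    restrict Ψ Γ (Ψ.root (rootLift α)) = α := α.2.choose_spec

variable [Finite ι] [Finite Γ]

/-- The restricted root datum. -/
noncomputable def restrictedRootDatum [Module.Finite ℤ X] (hΔ : IsSimpleSet Ψ Δ)
    (hΓ : ∀ γ ∈ Γ, ∀ i ∈ Δ, γ • i ∈ Δ) :
    RootDatum (restrictedRoots Ψ Γ) (RestrictedWeight Ψ Γ) (fixedCoweight Ψ Γ) :=
  have : Finite (restrictedRoots Ψ Γ) := Set.finite_range _
  RootPairing.mk' (restrictedPairing Ψ Γ) (Function.Embedding.subtype _)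
    ⟨fun α ↦ ⟨_, restrictedCoroot_mem hΔ hΓ (rootLift α)⟩, fun α α' h ↦ Subtype.ext <| by
      rw [← restrict_rootLift α, ← restrict_rootLift α']
      exact restrict_eq_of_restrictedCoroot_eq hΔ hΓ (congrArg Subtype.val h)⟩
    (fun α ↦ by
      change restrictedPairing Ψ Γ (α : RestrictedWeight Ψ Γ) _ = 2
      rw [← restrict_rootLift α]
      exact toLinearMap_root_restrictedCoroot_self hΔ hΓ _)
    (by
      rintro α _ ⟨α', rfl⟩
      obtain ⟨η, hη, -⟩ := exists_restrict_root_eq hΔ hΓ (rootLift α) (rootLift α')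
      refine ⟨⟨_, η, rfl⟩, hη.trans ?_⟩
      rw [← restrictedPairing_restrict Ψ Γ _ ⟨_, restrictedCoroot_mem hΔ hΓ _⟩,
        restrict_rootLift, restrict_rootLift]
      rfl)
    (by
      rintro α _ ⟨α', rfl⟩
      obtain ⟨η, -, hη⟩ := exists_restrict_root_eq hΔ hΓ (rootLift α) (rootLift α')
      refine ⟨⟨_, η, rfl⟩, Subtype.ext <| (restrictedCoroot_eq_of_restrict_eq hΔ hΓ
        (restrict_rootLift _)).trans (hη.trans ?_)⟩
      rw [← restrictedPairing_restrict Ψ Γ _ ⟨_, restrictedCoroot_mem hΔ hΓ _⟩,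
        restrict_rootLift]
      rfl)

variable (hΔ : IsSimpleSet Ψ Δ) (hΓ : ∀ γ ∈ Γ, ∀ i ∈ Δ, γ • i ∈ Δ)

lemma exists_fixedWeylGroup_restrict [Module.Finite ℤ X] {w : (restrictedRootDatum hΔ hΓ).Aut}
    (hw : w ∈ (restrictedRootDatum hΔ hΓ).weylGroup) :
    ∃ v : fixedWeylGroup Ψ Γ, ∀ x : X,
      w • restrict Ψ Γ x = restrict Ψ Γ ((v : Ψ.Aut) • x) := by
  induction hw using weylGroup.induction with
  | mem α =>
    obtain ⟨v, hv, hv'⟩ := exists_restrict_smul_eq hΔ hΓ (rootLift α)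
    refine ⟨⟨v, hv⟩, fun x ↦ (Eq.trans ?_ (hv' x).symm)⟩
    rw [restrict_rootLift]
    rfl
  | one => exact ⟨1, fun x ↦ by rw [one_smul, OneMemClass.coe_one, one_smul]⟩
  | mul w₁ w₂ _ _ h₁ h₂ =>
    obtain ⟨v₁, hv₁⟩ := h₁
    obtain ⟨v₂, hv₂⟩ := h₂
    exact ⟨v₁ * v₂, fun x ↦ by rw [mul_smul, hv₂, hv₁, ← mul_smul]; rfl⟩

include hΔ hΓ in
lemma fixedWeylGroup_ext {v w : fixedWeylGroup Ψ Γ}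
    (h : ∀ x : X, restrict Ψ Γ ((v : Ψ.Aut) • x) = restrict Ψ Γ ((w : Ψ.Aut) • x)) : v = w :=
  Subtype.ext (eq_of_restrict_smul_eq hΔ hΓ v.2 w.2 h)

-- Faithfulness makes each lift unique, which gives both multiplicativity and uniqueness of the map.
-- Injectivity holds because an automorphism is determined by its action on weights and restriction
-- is surjective.
include hΔ hΓ in
lemma existsUnique_weylGroup_hom {κ B : Type*} [AddCommGroup B]
    (Ψ' : RootDatum κ (RestrictedWeight Ψ Γ) B)
    (H : ∀ w ∈ Ψ'.weylGroup, ∃ v : fixedWeylGroup Ψ Γ, ∀ x : X,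
      w • restrict Ψ Γ x = restrict Ψ Γ ((v : Ψ.Aut) • x)) :
    ∃! f : Ψ'.weylGroup →* fixedWeylGroup Ψ Γ,
      Function.Injective f ∧
      ∀ (w : Ψ'.weylGroup) (x : X),
        (w : Ψ'.Aut) • restrict Ψ Γ x = restrict Ψ Γ ((f w : Ψ.Aut) • x) := by
  choose f hf using fun w : Ψ'.weylGroup ↦ H w w.2
  have hmul (v w : Ψ'.weylGroup) : f (v * w) = f v * f w := by
    refine fixedWeylGroup_ext hΔ hΓ fun x ↦ ?_
    rw [← hf, Subgroup.coe_mul, Subgroup.coe_mul, mul_smul, mul_smul, hf, hf]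
  refine ⟨MonoidHom.mk' f hmul, ⟨?_, hf⟩, ?_⟩
  · intro v w h
    refine Subtype.ext (aut_ext fun a ↦ ?_)
    obtain ⟨x, rfl⟩ := restrict_surjective Ψ Γ a
    rw [hf, hf]
    exact congrArg (fun u : fixedWeylGroup Ψ Γ ↦ restrict Ψ Γ ((u : Ψ.Aut) • x)) h
  · rintro g ⟨-, hg⟩
    refine MonoidHom.ext fun w ↦ fixedWeylGroup_ext hΔ hΓ fun x ↦ ?_
    rw [← hg]
    exact hf w x

end RootPairing

theorem mainTheorem3 {ι X Y : Type*} [Finite ι] [AddCommGroup X] [AddCommGroup Y]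
    [Module.Finite ℤ X] [Module.Finite ℤ Y] (Ψ : RootDatum ι X Y)
    (Γ : Subgroup Ψ.Aut) [Finite Γ]
    (hΓ : ∃ Δ : Set ι, RootPairing.IsSimpleSet Ψ Δ ∧ ∀ γ ∈ Γ, ∀ i ∈ Δ, γ • i ∈ Δ) :
    (∀ β : ι, (RootPairing.Xi Ψ Γ β).ncard ∣ (MulAction.orbit Γ β).ncard) ∧
    Finite (RootPairing.restrictedRoots Ψ Γ) ∧
    Module.Free ℤ (RootPairing.RestrictedWeight Ψ Γ) ∧
    Module.Finite ℤ (RootPairing.RestrictedWeight Ψ Γ) ∧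
    Module.Free ℤ (RootPairing.fixedCoweight Ψ Γ) ∧
    Module.Finite ℤ (RootPairing.fixedCoweight Ψ Γ) ∧
    ∃ Ψbar : RootDatum (RootPairing.restrictedRoots Ψ Γ)
        (RootPairing.RestrictedWeight Ψ Γ) (RootPairing.fixedCoweight Ψ Γ),
      (∀ (x : X) (y : RootPairing.fixedCoweight Ψ Γ),
        Ψbar.toLinearMap (RootPairing.restrict Ψ Γ x) y = Ψ.toLinearMap x (y : Y)) ∧
      (∀ α : RootPairing.restrictedRoots Ψ Γ,
        Ψbar.root α = (α : RootPairing.RestrictedWeight Ψ Γ)) ∧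
      (∀ (α : RootPairing.restrictedRoots Ψ Γ) (β : ι),
        RootPairing.restrict Ψ Γ (Ψ.root β) = (α : RootPairing.RestrictedWeight Ψ Γ) →
        (Ψbar.coroot α : Y) =
          ((MulAction.orbit Γ β).ncard / (RootPairing.Xi Ψ Γ β).ncard) •
            ∑ᶠ ξ ∈ RootPairing.Xi Ψ Γ β, Ψ.coroot ξ) ∧
      ∃! f : Ψbar.weylGroup →* RootPairing.fixedWeylGroup Ψ Γ,
        Function.Injective f ∧
        ∀ (w : Ψbar.weylGroup) (x : X),
          (w : Ψbar.Aut) • RootPairing.restrict Ψ Γ x =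
            RootPairing.restrict Ψ Γ ((f w : Ψ.Aut) • x) := by
  obtain ⟨Δ, hΔ, hΓ⟩ := hΓ
  refine ⟨RootPairing.ncard_Xi_dvd hΔ hΓ, Set.finite_range _, inferInstance, inferInstance,
    RootPairing.free_fixedCoweight Ψ Γ, RootPairing.finite_fixedCoweight Ψ Γ,
    RootPairing.restrictedRootDatum hΔ hΓ, fun x y ↦ rfl, fun α ↦ rfl, fun α β h ↦ ?_,
    RootPairing.existsUnique_weylGroup_hom hΔ hΓ _
      fun w hw ↦ RootPairing.exists_fixedWeylGroup_restrict hΔ hΓ hw⟩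
  exact RootPairing.restrictedCoroot_eq_of_restrict_eq hΔ hΓ
    ((RootPairing.restrict_rootLift α).trans h.symm)
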